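/- For integers $m>k\ge 0$ and $0<z\le\pi/2$ let $$\mathrm{ls}_m^{(k)}(z) = -\int_0^z t^k \log^{m-1-k}\!\left(\frac{\sin t}{\sin z}\right)dt ,$$ and let $\mathrm{Li}_m$ denote the classical polylogarithm, i.e. the analytic continuation of $\sum_{n\ge1} x^n/n^m$ $(|x|<1)$ to $\mathbb{C}\setminus[1,\infty)$. Then for every real $z$ with $0<z<\pi/2$ the integrals and series below converge, and $$\mathrm{ls}_3^{(1)}(z)=\frac18\sum_{n=1}^\infty\frac{(2\sin z)^{2n}}{n^3\binom{2n}{n}}=\frac z2\,\mathrm{Im}\,\mathrm{Li}_2(1-e^{-2iz})-\frac12\,\mathrm{Re}\,\mathrm{Li}_3(1-e^{-2iz}),$$ $$\mathrm{ls}_4^{(1)}(z)=-\frac18\sum_{n=1}^\infty\frac{(2\sin z)^{2n}}{n^4\binom{2n}{n}}=-\frac{z^4}4+\mathrm{Re}\,\mathrm{Li}_4(1-e^{-2iz})-z\,\mathrm{Im}\,\mathrm{Li}_3(1-e^{-2iz}),$$ $$\begin{aligned}\mathrm{ls}_5^{(1)}(z)=\frac3{16}\sum_{n=1}^\infty\frac{(2\sin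 z)^{2n}}{n^5\binom{2n}{n}}={}&\frac{3z^4}{4}\log(2\sin z)+\frac38\zeta(5)+\frac{3z^2}{4}\zeta(3)\\&+\frac{3z}{4}\left(\mathrm{Im}\,\mathrm{Li}_4(e^{-2iz})+4\,\mathrm{Im}\,\mathrm{Li}_4(1-e^{-2iz})\right)\\&-\frac38\left(\mathrm{Re}\,\mathrm{Li}_5(e^{-2iz})+8\,\mathrm{Re}\,\mathrm{Li}_5(1-e^{-2iz})\right).\end{aligned}$$ -/

import Mathlib

/-- The normalized log-sine integral
`ls_m^{(k)}(z) = -∫_0^z t^k log (sin t / sin z)^(m-1-k) dt`, for `0 ≤ k < m` and `0 < z ≤ π/2`. -/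
noncomputable def normLogSine (m k : ℕ) (z : ℝ) : ℝ :=
  -∫ t in (0 : ℝ)..z, t ^ k * Real.log (Real.sin t / Real.sin z) ^ (m - 1 - k)

/-- The classical polylogarithm `Li_m` on `ℂ \ [1, ∞)` (principal branch):
`Li_0(x) = x / (1 - x)` and `Li_{k+1}(x) = (1 / k!) ∫_0^∞ s^k x / (e^s - x) ds`.
It is the analytic continuation to `ℂ \ [1, ∞)` of `∑_{n ≥ 1} x^n / n^m`, `|x| < 1`: see
`polylog_eq_tsum` and `differentiableOn_polylog`. -/
noncomputable def polylog : ℕ → ℂ → ℂ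
  | 0, x => x / (1 - x)
  | k + 1, x => (1 / (k.factorial : ℂ)) *
      ∫ s in Set.Ioi (0 : ℝ), (s : ℂ) ^ k * (x / (Complex.exp (s : ℂ) - x))

lemma integral_pow_mul_exp_aux (k n : ℕ) :
    ∫ s in Set.Ioi (0 : ℝ), s ^ k * Real.exp (-((n + 1 : ℝ) * s)) =
      k.factorial / (n + 1 : ℝ) ^ (k + 1) := by
  have h := Real.integral_rpow_mul_exp_neg_mul_Ioi (a := (k : ℝ) + 1) (r := (n : ℝ) + 1)
    (by positivity) (by positivity)
  rw [Real.Gamma_nat_eq_factorial] at h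
  simp only [add_sub_cancel_right, Real.rpow_natCast] at h
  rw [h]
  have : (1 / ((n : ℝ) + 1)) ^ ((k : ℝ) + 1) = (1 / ((n : ℝ) + 1)) ^ (k + 1) := by
    rw [← Real.rpow_natCast]; push_cast; rfl
  rw [this, one_div, inv_pow]
  field_simp

lemma integrable_pow_mul_exp_aux (k n : ℕ) :
    MeasureTheory.IntegrableOn (fun s : ℝ => s ^ k * Real.exp (-((n + 1 : ℝ) * s)))
      (Set.Ioi (0 : ℝ)) := by
  by_contra hc
  have h := integral_pow_mul_exp_aux k n
  rw [MeasureTheory.integral_undef hc] at h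
  have : (0 : ℝ) < k.factorial / (n + 1 : ℝ) ^ (k + 1) := by positivity
  linarith

/-- On the unit disc `polylog m` is the usual power series. -/
theorem polylog_eq_tsum (m : ℕ) (x : ℂ) (hx : ‖x‖ < 1) :
    polylog m x = ∑' n : ℕ, x ^ (n + 1) / ((n : ℂ) + 1) ^ m := by
  cases m with
  | zero =>
    simp only [polylog, pow_zero, div_one, pow_succ]
    rw [tsum_mul_right, tsum_geometric_of_norm_lt_one hx]
    ring
  | succ k =>
    let F : ℕ → ℝ → ℂ := fun n s =>
      x ^ (n + 1) * ((s ^ k * Real.exp (-((n + 1 : ℝ) * s)) : ℝ) : ℂ)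
    have hFint : ∀ n, MeasureTheory.Integrable (F n)
        (MeasureTheory.volume.restrict (Set.Ioi (0 : ℝ))) := fun n =>
      (MeasureTheory.Integrable.ofReal (integrable_pow_mul_exp_aux k n)).const_mul _
    have hnorm : ∀ n, ∫ s in Set.Ioi (0 : ℝ), ‖F n s‖ =
        ‖x‖ ^ (n + 1) * (k.factorial / (n + 1 : ℝ) ^ (k + 1)) := by
      intro n
      rw [← integral_pow_mul_exp_aux k n, ← MeasureTheory.integral_const_mul]
      refine MeasureTheory.setIntegral_congr_fun measurableSet_Ioi fun s hs => ?_
      have hs' : (0 : ℝ) < s := hs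
      simp only [F, norm_mul, norm_pow, Complex.norm_real, Real.norm_eq_abs]
      rw [abs_of_pos hs', abs_of_pos (Real.exp_pos _)]
    have hsum : Summable fun n => ∫ s in Set.Ioi (0 : ℝ), ‖F n s‖ := by
      simp only [hnorm]
      refine Summable.of_nonneg_of_le (fun n => by positivity) (fun n => ?_)
        (((summable_geometric_of_lt_one (norm_nonneg x) hx)).mul_right (k.factorial : ℝ))
      have h1 : ‖x‖ ^ (n + 1) ≤ ‖x‖ ^ n := pow_le_pow_of_le_one (norm_nonneg x) hx.le (by omega)
      have h2 : (k.factorial / (n + 1 : ℝ) ^ (k + 1)) ≤ k.factorial := by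
        apply div_le_self (by positivity)
        apply one_le_pow₀
        have : (0 : ℝ) ≤ n := by positivity
        linarith
      gcongr
    have key := MeasureTheory.integral_tsum_of_summable_integral_norm hFint hsum
    have hval : ∀ n, ∫ s in Set.Ioi (0 : ℝ), F n s =
        x ^ (n + 1) * (k.factorial / ((n : ℂ) + 1) ^ (k + 1)) := by
      intro n
      simp only [F]
      rw [MeasureTheory.integral_const_mul, integral_complex_ofReal, integral_pow_mul_exp_aux]
      push_cast
      rfl
    have hfun : ∀ s ∈ Set.Ioi (0 : ℝ),
        ∑' n, F n s = (s : ℂ) ^ k * (x / (Complex.exp (s : ℂ) - x)) := by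
      intro s hs
      have hs' : (0 : ℝ) < s := hs
      have he : Complex.exp (s : ℂ) ≠ 0 := Complex.exp_ne_zero _
      have hlt : ‖x * Complex.exp (-(s : ℂ))‖ < 1 := by
        rw [norm_mul, Complex.norm_exp]
        have : Real.exp (-(s : ℂ)).re ≤ 1 := by simp [hs'.le]
        nlinarith [norm_nonneg x, Real.exp_pos (-(s : ℂ)).re]
      have hF : ∀ n, F n s =
          ((s : ℂ) ^ k * (x * Complex.exp (-(s : ℂ)))) * (x * Complex.exp (-(s : ℂ))) ^ n := by
        intro n
        have : Complex.exp (-(((n : ℂ) + 1) * s)) = Complex.exp (-(s : ℂ)) ^ (n + 1) := by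
          rw [← Complex.exp_nat_mul]; congr 1; push_cast; ring
        simp only [F]
        push_cast
        rw [this]
        ring
      simp only [hF]
      rw [tsum_mul_left, tsum_geometric_of_norm_lt_one hlt, Complex.exp_neg]
      have hne : Complex.exp (s : ℂ) - x ≠ 0 := by
        intro h0
        have h1 : Complex.exp (s : ℂ) = x := sub_eq_zero.mp h0
        rw [Complex.exp_neg, ← h1, mul_inv_cancel₀ he] at hlt
        simp at hlt
      have hne' : 1 - x * (Complex.exp (s : ℂ))⁻¹ ≠ 0 := by
        intro h0
        apply hne
        field_simp at h0
        simpa using h0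
      field_simp
    rw [MeasureTheory.setIntegral_congr_fun measurableSet_Ioi hfun] at key
    simp only [polylog]
    rw [← key, ← tsum_mul_left]
    refine tsum_congr fun n => ?_
    rw [hval]
    have : (k.factorial : ℂ) ≠ 0 := by exact_mod_cast k.factorial_ne_zero
    field_simp

/-- `polylog m` is holomorphic on `ℂ \ [1, ∞)`. -/
theorem differentiableOn_polylog (m : ℕ) :
    DifferentiableOn ℂ (polylog m) {x | ∀ r : ℝ, 1 ≤ r → x ≠ (r : ℂ)} := by
  have hset : {x : ℂ | ∀ r : ℝ, 1 ≤ r → x ≠ (r : ℂ)} = {x | 1 - x ∈ Complex.slitPlane} := by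
    ext x
    simp only [Set.mem_ofPred_eq, Complex.mem_slitPlane_iff]
    constructor
    · intro h
      by_contra hc
      push Not at hc
      simp only [Complex.sub_re, Complex.one_re, Complex.sub_im, Complex.one_im] at hc
      exact h x.re (by linarith [hc.1]) (Complex.ext (by simp) (by simp; linarith [hc.2]))
    · rintro h r hr rfl
      simp at h
      linarith
  rw [hset]
  have hopen : IsOpen {x : ℂ | 1 - x ∈ Complex.slitPlane} :=
    Complex.isOpen_slitPlane.preimage (by fun_prop)
  intro x₀ hx₀
  apply DifferentiableAt.differentiableWithinAt
  cases m with
  | zero =>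
    have h0 : (1 : ℂ) - x₀ ≠ 0 := Complex.slitPlane_ne_zero hx₀
    change DifferentiableAt ℂ (fun x : ℂ => x / (1 - x)) x₀
    fun_prop (disch := exact h0)
  | succ k =>
    obtain ⟨ε, hε, hball⟩ := Metric.nhds_basis_closedBall.mem_iff.mp (hopen.mem_nhds hx₀)
    obtain ⟨c, hc, hcb⟩ : ∃ c > 0, ∀ u ∈ Set.Icc (0 : ℝ) 1, ∀ x ∈ Metric.closedBall x₀ ε,
        c ≤ ‖1 - (u : ℂ) * x‖ := by
      have hK : IsCompact (Set.Icc (0 : ℝ) 1 ×ˢ Metric.closedBall x₀ ε) :=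
        isCompact_Icc.prod (isCompact_closedBall x₀ ε)
      have hcont : ContinuousOn (fun p : ℝ × ℂ => ‖1 - (p.1 : ℂ) * p.2‖)
          (Set.Icc (0 : ℝ) 1 ×ˢ Metric.closedBall x₀ ε) := by fun_prop
      obtain ⟨p, hp, hmin⟩ := hK.exists_isMinOn
        ⟨(0, x₀), ⟨by simp, Metric.mem_closedBall_self hε.le⟩⟩ hcont
      refine ⟨‖1 - (p.1 : ℂ) * p.2‖, ?_, fun u hu x hx => hmin (Set.mk_mem_prod hu hx)⟩
      rw [gt_iff_lt, norm_pos_iff]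
      intro h0
      have hsl : 1 - p.2 ∈ Complex.slitPlane := hball hp.2
      have hp1 := hp.1
      have hne : p.1 ≠ 0 := by
        intro h; simp [h] at h0
      have hpos : 0 < p.1 := lt_of_le_of_ne hp1.1 (Ne.symm hne)
      have hre := congrArg Complex.re h0
      have him := congrArg Complex.im h0
      simp at hre him
      rw [Complex.mem_slitPlane_iff] at hsl
      simp at hsl
      rcases him with him | him
      · exact hne him
      · rcases hsl with hsl | hsl
        · nlinarith [hp1.2]
        · exact hsl him
    have hlow : ∀ s ∈ Set.Ioi (0 : ℝ), ∀ x ∈ Metric.closedBall x₀ ε,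
        c * Real.exp s ≤ ‖Complex.exp (s : ℂ) - x‖ := by
      intro s hs x hx
      have hs' : (0 : ℝ) < s := hs
      have h1 := hcb (Real.exp (-s)) ⟨(Real.exp_pos _).le, by simp [hs'.le]⟩ x hx
      have h2 : Complex.exp (s : ℂ) - x =
          Complex.exp (s : ℂ) * (1 - ((Real.exp (-s) : ℝ) : ℂ) * x) := by
        push_cast
        rw [Complex.exp_neg]
        field_simp
      rw [h2, norm_mul, Complex.norm_exp, Complex.ofReal_re, mul_comm]
      gcongr
    have hne : ∀ s ∈ Set.Ioi (0 : ℝ), ∀ x ∈ Metric.closedBall x₀ ε,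
        Complex.exp (s : ℂ) - x ≠ 0 := by
      intro s hs x hx
      rw [← norm_pos_iff]
      exact lt_of_lt_of_le (mul_pos hc (Real.exp_pos s)) (hlow s hs x hx)
    have hx₀b : x₀ ∈ Metric.closedBall x₀ ε := Metric.mem_closedBall_self hε.le
    have hmeas : ∀ x : ℂ, Measurable fun s : ℝ =>
        (s : ℂ) ^ k * (x / (Complex.exp (s : ℂ) - x)) := fun x => by fun_prop
    have hint0 : MeasureTheory.IntegrableOn (fun s : ℝ => s ^ k * Real.exp (-s))
        (Set.Ioi (0 : ℝ)) := by
      simpa using integrable_pow_mul_exp_aux k 0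
    have hmain := hasDerivAt_integral_of_dominated_loc_of_deriv_le
      (μ := MeasureTheory.volume.restrict (Set.Ioi (0 : ℝ)))
      (F := fun (x : ℂ) (s : ℝ) => (s : ℂ) ^ k * (x / (Complex.exp (s : ℂ) - x)))
      (F' := fun (x : ℂ) (s : ℝ) =>
        (s : ℂ) ^ k * (Complex.exp (s : ℂ) / (Complex.exp (s : ℂ) - x) ^ 2))
      (bound := fun s : ℝ => (s ^ k * Real.exp (-s)) * (1 / c ^ 2))
      (x₀ := x₀) (Metric.closedBall_mem_nhds x₀ hε)
      (Filter.Eventually.of_forall fun x => (hmeas x).aestronglyMeasurable)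
      ?_ ?_ ?_ ?_ ?_
    · exact (hmain.2.differentiableAt.const_mul _)
    · refine MeasureTheory.Integrable.mono' (hint0.mul_const (‖x₀‖ / c))
        (hmeas x₀).aestronglyMeasurable ?_
      filter_upwards [MeasureTheory.ae_restrict_mem measurableSet_Ioi] with s hs
      have hs' : (0 : ℝ) < s := hs
      have hl := hlow s hs x₀ hx₀b
      rw [norm_mul, norm_pow, Complex.norm_real, Real.norm_of_nonneg hs'.le, norm_div]
      calc s ^ k * (‖x₀‖ / ‖Complex.exp (s : ℂ) - x₀‖)
          ≤ s ^ k * (‖x₀‖ / (c * Real.exp s)) := by gcongr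
        _ = s ^ k * Real.exp (-s) * (‖x₀‖ / c) := by
          rw [Real.exp_neg]; field_simp
    · exact Measurable.aestronglyMeasurable (by fun_prop)
    · filter_upwards [MeasureTheory.ae_restrict_mem measurableSet_Ioi] with s hs x hx
      have hs' : (0 : ℝ) < s := hs
      have hl := hlow s hs x hx
      rw [norm_mul, norm_pow, Complex.norm_real, Real.norm_of_nonneg hs'.le, norm_div, norm_pow,
        Complex.norm_exp, Complex.ofReal_re]
      calc s ^ k * (Real.exp s / ‖Complex.exp (s : ℂ) - x‖ ^ 2)
          ≤ s ^ k * (Real.exp s / (c * Real.exp s) ^ 2) := by gcongr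
        _ = s ^ k * Real.exp (-s) * (1 / c ^ 2) := by
          rw [Real.exp_neg]; field_simp
    · exact hint0.mul_const _
    · filter_upwards [MeasureTheory.ae_restrict_mem measurableSet_Ioi] with s hs x hx
      have h := ((hasDerivAt_id x).div ((hasDerivAt_id x).const_sub (Complex.exp (s : ℂ)))
        (hne s hs x hx)).const_mul ((s : ℂ) ^ k)
      refine h.congr_deriv ?_
      congr 2
      simp

/-! Put J_p(z) = ∫_0^z t log^p(sin t / sin z) dt, so that ls_{p+2}^{(1)} = -J_p, and u = e^{-2iz}.
The integral, the series and the polylogarithmic expression climb the same ladder of differential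
equations on (0, π/2). Each rung is fixed by its derivative and the limit 0 as z → 0+
(`eq_of_hasDerivAt_eq`).

The integrand of J_{p+1} vanishes at t = z, so J_{p+1}' = -(p+1) cot z · J_p, starting from J_0 =
z²/2 (`hasDerivAt_logSinRatioIntegral`). The central binomial series satisfy S_{m+1}' = 2 cot z ·
S_m, starting from S_2 = 2z² (`centralBinomSum_two`). Induction makes J_p a multiple of S_{p+2}.

Along the arc, Li_{m+1}(1-u) has derivative (cot z - i) Li_m(1-u) and Li_{m+1}(u) has derivative -2i
Li_m(u). In each closed form the terms with cot z differentiate to -(p+1) cot z times the previous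
one. The others cancel: for p = 1 because Li_1(1-u) = 2iz, for p = 2 because Re Li_2(1-u) = z², for
p = 3 by a weight-three functional equation (`polylogArc_three_re`).

As |1-u| = 2 sin z may exceed 1, x Li_{m+1}' = Li_m is first carried from the disc to the cut plane
by the identity theorem. The zeta values enter as limits of Li_m(u) as u → 1. -/

open Filter Topology MeasureTheory

/-! ### Polylogarithms on the cut plane and on the closed unit disc -/

/-- The domain `ℂ \ [1, ∞)` of the principal branch of the polylogarithms. -/
def polylogDomain : Set ℂ := {x | 1 - x ∈ Complex.slitPlane}

lemma mem_polylogDomain {x : ℂ} : x ∈ polylogDomain ↔ 1 - x ∈ Complex.slitPlane := Iff.rfl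

lemma isOpen_polylogDomain : IsOpen polylogDomain :=
  Complex.isOpen_slitPlane.preimage (by fun_prop)

lemma isPreconnected_polylogDomain : IsPreconnected polylogDomain := by
  have h : polylogDomain = (fun x : ℂ => 1 - x) '' Complex.slitPlane := by
    ext x
    constructor
    · intro hx
      exact ⟨1 - x, hx, by ring⟩
    · rintro ⟨y, hy, rfl⟩
      simpa [mem_polylogDomain] using hy
  rw [h]
  refine IsPreconnected.image ?_ _ (by fun_prop)
  exact (Complex.starConvex_one_slitPlane.isPathConnected
    Complex.one_mem_slitPlane).isConnected.isPreconnected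

lemma mem_polylogDomain_of_norm_lt_one {x : ℂ} (hx : ‖x‖ < 1) : x ∈ polylogDomain := by
  rw [mem_polylogDomain, sub_eq_add_neg]
  exact Complex.mem_slitPlane_of_norm_lt_one (by simpa using hx)

lemma analyticOnNhd_polylog (m : ℕ) : AnalyticOnNhd ℂ (polylog m) polylogDomain := by
  refine DifferentiableOn.analyticOnNhd ?_ isOpen_polylogDomain
  refine (differentiableOn_polylog m).mono fun x hx r hr hxr => ?_
  rw [mem_polylogDomain, hxr, Complex.mem_slitPlane_iff] at hx
  simp at hx
  linarith

/-- A function that is analytic on `ℂ \ [1, ∞)` is determined by its values on the unit disc. -/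
lemma eqOn_polylogDomain {f g : ℂ → ℂ} (hf : AnalyticOnNhd ℂ f polylogDomain)
    (hg : AnalyticOnNhd ℂ g polylogDomain) (h : ∀ x : ℂ, ‖x‖ < 1 → f x = g x) :
    Set.EqOn f g polylogDomain := by
  refine hf.eqOn_of_preconnected_of_eventuallyEq hg isPreconnected_polylogDomain
    (mem_polylogDomain_of_norm_lt_one (x := 0) (by simp)) ?_
  filter_upwards [Metric.ball_mem_nhds (0 : ℂ) one_pos] with x hx
  exact h x (by simpa using hx)

lemma polylog_zero_right (m : ℕ) : polylog m 0 = 0 := by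
  cases m <;> simp [polylog]

lemma polylog_one_eq_neg_log {x : ℂ} (hx : x ∈ polylogDomain) :
    polylog 1 x = -Complex.log (1 - x) := by
  refine eqOn_polylogDomain (g := fun x => -Complex.log (1 - x)) (analyticOnNhd_polylog 1)
    ?_ ?_ hx
  · refine DifferentiableOn.analyticOnNhd (fun y hy => ?_) isOpen_polylogDomain
    have hy' : 1 - y ∈ Complex.slitPlane := hy
    exact DifferentiableAt.differentiableWithinAt (by fun_prop (disch := exact hy'))
  · intro y hy
    have h := Complex.hasSum_taylorSeries_neg_log hy
    -- The Taylor series is indexed from n = 0, where its term y ^ 0 / 0 is 0 by convention.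
    rw [← hasSum_nat_add_iff' 1] at h
    simp only [Finset.sum_range_one, Nat.cast_zero, div_zero, sub_zero] at h
    rw [polylog_eq_tsum 1 y hy, ← h.tsum_eq]
    push_cast
    simp

lemma mul_deriv_polylog_of_norm_lt_one (m : ℕ) {x : ℂ} (hx : ‖x‖ < 1) :
    x * deriv (polylog (m + 1)) x = polylog m x := by
  obtain ⟨r, hxr, hr⟩ := exists_between hx
  have hr0 : 0 ≤ r := (norm_nonneg x).trans hxr.le
  have hU : IsOpen (Metric.ball (0 : ℂ) r) := Metric.isOpen_ball
  have hxU : x ∈ Metric.ball (0 : ℂ) r := by simpa using hxr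
  have hs : Summable fun n : ℕ => r ^ (n + 1) := by
    simpa [pow_succ] using (summable_geometric_of_lt_one hr0 hr).mul_right r
  have h := Complex.hasSum_deriv_of_summable_norm (U := Metric.ball (0 : ℂ) r) (z := x)
    (F := fun (n : ℕ) (y : ℂ) => y ^ (n + 1) / ((n : ℂ) + 1) ^ (m + 1)) hs
    (fun n => by fun_prop) hU (fun n w hw => ?_) hxU
  · have heq : deriv (fun w : ℂ => ∑' n : ℕ, w ^ (n + 1) / ((n : ℂ) + 1) ^ (m + 1)) x =
        deriv (polylog (m + 1)) x := by
      apply Filter.EventuallyEq.deriv_eq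
      filter_upwards [hU.mem_nhds hxU] with y hy
      rw [polylog_eq_tsum _ y ((by simpa using hy : ‖y‖ < r).trans hr)]
    rw [heq] at h
    rw [← h.tsum_eq, ← tsum_mul_left, polylog_eq_tsum m x hx]
    refine tsum_congr fun n => ?_
    have hn : ((n : ℂ) + 1) ≠ 0 := by exact_mod_cast n.succ_ne_zero
    rw [deriv_div_const, deriv_pow_field]
    field_simp
    rw [Nat.add_sub_cancel]
    push_cast
    ring
  · have hw' : ‖w‖ < r := by simpa using hw
    have hn : (1 : ℝ) ≤ ‖((n : ℂ) + 1) ^ (m + 1)‖ := by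
      have : ((n : ℂ) + 1) = ((n + 1 : ℕ) : ℂ) := by push_cast; rfl
      rw [norm_pow, this, Complex.norm_natCast]
      exact one_le_pow₀ (by exact_mod_cast n.succ_pos)
    rw [norm_div, norm_pow]
    refine (div_le_self (by positivity) hn).trans ?_
    gcongr

/-- `x Li_{m+1}'(x) = Li_m(x)` on `ℂ \ [1, ∞)`. -/
lemma hasDerivAt_polylog (m : ℕ) {x : ℂ} (hx : x ∈ polylogDomain) (hx0 : x ≠ 0) :
    HasDerivAt (polylog (m + 1)) (polylog m x / x) x := by
  have h : x * deriv (polylog (m + 1)) x = polylog m x :=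
    eqOn_polylogDomain (f := fun x => x * deriv (polylog (m + 1)) x)
      (analyticOnNhd_id.mul (analyticOnNhd_polylog (m + 1)).deriv) (analyticOnNhd_polylog m)
      (fun y hy => mul_deriv_polylog_of_norm_lt_one m hy) hx
  rw [← h, mul_div_cancel_left₀ _ hx0]
  exact (analyticOnNhd_polylog (m + 1) x hx).differentiableAt.hasDerivAt

/-- The polylogarithms of order at least two are continuous on the closed unit disc. -/
lemma continuousOn_polylog_closedBall (m : ℕ) :
    ContinuousOn (polylog (m + 2)) (Metric.closedBall 0 1) := by
  have hlow : ∀ x ∈ Metric.closedBall (0 : ℂ) 1, ∀ s : ℝ, 0 < s →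
      s * Real.exp (s / 2) ≤ ‖Complex.exp s - x‖ := by
    intro x hx s hs
    have hx' : ‖x‖ ≤ 1 := by simpa using hx
    -- Uses e^s - 1 = 2 e^{s/2} sinh(s/2) ≥ s e^{s/2}. The factor s absorbs one power of s in the
    -- integrand, so the bound remains integrable at s = 0 even for x = 1.
    have h1 : s / 2 ≤ Real.sinh (s / 2) := Real.self_le_sinh_iff.mpr (by positivity)
    rw [Real.sinh_eq] at h1
    have h2 : Real.exp s = Real.exp (s / 2) * Real.exp (s / 2) := by
      rw [← Real.exp_add]; ring_nf
    have h3 : Real.exp (s / 2) * Real.exp (-(s / 2)) = 1 := by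
      rw [← Real.exp_add]; simp
    have h4 : Real.exp s - 1 ≤ ‖Complex.exp s - x‖ := by
      have := norm_sub_norm_le (Complex.exp s) x
      rw [Complex.norm_exp, Complex.ofReal_re] at this
      linarith
    nlinarith [Real.exp_pos (s / 2)]
  have hint : IntegrableOn (fun s : ℝ => s ^ m * Real.exp (-(s / 2))) (Set.Ioi 0) := by
    have h := integrableOn_rpow_mul_exp_neg_mul_rpow (s := m) (p := 1) (b := 1 / 2)
      (by have : (0 : ℝ) ≤ m := m.cast_nonneg
          linarith) one_pos (by norm_num)
    refine h.congr_fun (fun s _ => ?_) measurableSet_Ioi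
    simp only [Real.rpow_natCast, Real.rpow_one]
    ring_nf
  have hdef : polylog (m + 2) = fun x => (1 / ((m + 1).factorial : ℂ)) *
      ∫ s in Set.Ioi (0 : ℝ), (s : ℂ) ^ (m + 1) * (x / (Complex.exp (s : ℂ) - x)) := by
    funext x
    rw [polylog]
  rw [hdef]
  refine ContinuousOn.const_mul ?_ _
  refine continuousOn_of_dominated (bound := fun s : ℝ => s ^ m * Real.exp (-(s / 2))) ?_ ?_ hint ?_
  · intro x _
    exact Measurable.aestronglyMeasurable (by fun_prop)
  · intro x hx
    filter_upwards [ae_restrict_mem measurableSet_Ioi] with s hs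
    have hs' : (0 : ℝ) < s := hs
    have hx' : ‖x‖ ≤ 1 := by simpa using hx
    rw [norm_mul, norm_pow, Complex.norm_real, Real.norm_of_nonneg hs'.le, norm_div]
    calc s ^ (m + 1) * (‖x‖ / ‖Complex.exp (s : ℂ) - x‖)
        ≤ s ^ (m + 1) * (1 / (s * Real.exp (s / 2))) := by
          gcongr
          exact hlow x hx s hs'
      _ = s ^ m * Real.exp (-(s / 2)) := by
          rw [Real.exp_neg]; field_simp; ring
  · filter_upwards [ae_restrict_mem measurableSet_Ioi] with s hs x hx
    have hs' : (0 : ℝ) < s := hs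
    have hne : Complex.exp (s : ℂ) - x ≠ 0 := by
      rw [← norm_pos_iff]
      exact lt_of_lt_of_le (by positivity) (hlow x hx s hs')
    exact ContinuousAt.continuousWithinAt (by fun_prop (disch := exact hne))

/-- The point 1 lies on the cut, so analyticity is of no use there. The integral and the power
series are both continuous on the closed disc and agree on the open disc, hence at 1. -/
lemma polylog_one_right (m : ℕ) : polylog (m + 2) 1 = riemannZeta (m + 2 : ℕ) := by
  have hcont : ContinuousOn (fun x : ℂ => ∑' n : ℕ, x ^ (n + 1) / ((n : ℂ) + 1) ^ (m + 2))
      (Metric.closedBall 0 1) := by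
    refine continuousOn_tsum (u := fun n : ℕ => 1 / ((n + 1 : ℕ) : ℝ) ^ (m + 2))
      (fun n => by fun_prop) ?_ ?_
    · exact (summable_nat_add_iff 1).mpr (Real.summable_one_div_nat_pow.mpr (by omega))
    · intro n x hx
      have hx' : ‖x‖ ≤ 1 := by simpa using hx
      have : ((n : ℂ) + 1) = ((n + 1 : ℕ) : ℂ) := by push_cast; rfl
      rw [norm_div, norm_pow, norm_pow, this, Complex.norm_natCast]
      gcongr
      exact pow_le_one₀ (norm_nonneg _) hx'
  have h : Set.EqOn (polylog (m + 2))
      (fun x : ℂ => ∑' n : ℕ, x ^ (n + 1) / ((n : ℂ) + 1) ^ (m + 2)) (Metric.closedBall 0 1) := by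
    refine Set.EqOn.of_subset_closure (s := Metric.ball 0 1) (fun x hx => ?_)
      (continuousOn_polylog_closedBall m) hcont Metric.ball_subset_closedBall
      (closure_ball (0 : ℂ) one_ne_zero).ge
    exact polylog_eq_tsum (m + 2) x (by simpa using hx)
  have h1 := h (x := 1) (by simp)
  rw [h1, zeta_nat_eq_tsum_of_gt_one (by omega)]
  have hs : Summable fun n : ℕ => 1 / (n : ℂ) ^ (m + 2) := by
    have hr : Summable fun n : ℕ => 1 / (n : ℝ) ^ (m + 2) :=
      Real.summable_one_div_nat_pow.mpr (by omega)
    simpa using Complex.ofRealCLM.summable hr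
  -- The extra n = 0 term is 1 / 0 ^ (m + 2) = 0.
  rw [hs.tsum_eq_zero_add]
  simp

/-! ### Central binomial series and their differential equation -/

/-- The `n`-th term (starting from `n = 0`) of `∑_{n ≥ 1} (2 sin z)^{2n} / (n^m (2n choose n))`. -/
noncomputable def centralBinomTerm (m n : ℕ) (z : ℝ) : ℝ :=
  (2 * Real.sin z) ^ (2 * (n + 1)) / (((n + 1 : ℕ) : ℝ) ^ m * ((2 * (n + 1)).choose (n + 1) : ℝ))

/-- The central binomial series `∑_{n ≥ 1} (2 sin z)^{2n} / (n^m (2n choose n))`. -/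
noncomputable def centralBinomSum (m : ℕ) (z : ℝ) : ℝ := ∑' n, centralBinomTerm m n z

/-- The ratio `4^n / (2n choose n)`. -/
noncomputable def fourPowDivCentralBinom (n : ℕ) : ℝ := 4 ^ n / (n.centralBinom : ℝ)

lemma fourPowDivCentralBinom_nonneg (n : ℕ) : 0 ≤ fourPowDivCentralBinom n := by
  unfold fourPowDivCentralBinom
  positivity

lemma fourPowDivCentralBinom_le {n : ℕ} (hn : 0 < n) : fourPowDivCentralBinom n ≤ 2 * n := by
  have h : (0 : ℝ) < n.centralBinom := by exact_mod_cast n.centralBinom_pos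
  rw [fourPowDivCentralBinom, div_le_iff₀ h]
  exact_mod_cast Nat.four_pow_le_two_mul_self_mul_centralBinom n hn

lemma fourPowDivCentralBinom_succ (n : ℕ) :
    (2 * n + 1) * fourPowDivCentralBinom (n + 1) = 2 * (n + 1) * fourPowDivCentralBinom n := by
  have h0 : (n.centralBinom : ℝ) ≠ 0 := by exact_mod_cast n.centralBinom_ne_zero
  have h1 : ((n + 1).centralBinom : ℝ) ≠ 0 := by exact_mod_cast (n + 1).centralBinom_ne_zero
  have h : ((n : ℝ) + 1) * ((n + 1).centralBinom : ℝ) = 2 * (2 * n + 1) * n.centralBinom := by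
    exact_mod_cast n.succ_mul_centralBinom_succ
  unfold fourPowDivCentralBinom
  rw [mul_div_assoc', mul_div_assoc', div_eq_div_iff h1 h0, pow_succ]
  linear_combination (-2 * 4 ^ n) * h

lemma centralBinomTerm_eq (m n : ℕ) (z : ℝ) :
    centralBinomTerm m n z =
      fourPowDivCentralBinom (n + 1) / ((n : ℝ) + 1) ^ m * Real.sin z ^ (2 * (n + 1)) := by
  unfold centralBinomTerm fourPowDivCentralBinom
  rw [Nat.centralBinom_eq_two_mul_choose, mul_pow, pow_mul 2]
  push_cast
  norm_num
  field_simp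

/-- The bound is uniform in m and depends on z only through s, so one majorant serves for
convergence, continuity and termwise differentiation. The exponent 1 matches the form of the
polynomial-times-geometric summability lemma. -/
lemma norm_centralBinomTerm_le (m n : ℕ) {z s : ℝ} (hs : |Real.sin z| ≤ s) :
    ‖centralBinomTerm m n z‖ ≤ 2 * (((n + 1 : ℕ) : ℝ) ^ 1 * (s ^ 2) ^ (n + 1)) := by
  have h1 : (1 : ℝ) ≤ ((n : ℝ) + 1) ^ m := one_le_pow₀ (by
    have : (0 : ℝ) ≤ n := n.cast_nonneg
    linarith)
  have h2 := fourPowDivCentralBinom_nonneg (n + 1)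
  have h3 := fourPowDivCentralBinom_le n.succ_pos
  have h4 : Real.sin z ^ (2 * (n + 1)) ≤ (s ^ 2) ^ (n + 1) := by
    rw [pow_mul, ← sq_abs]
    gcongr
  have h5 : 0 ≤ Real.sin z ^ (2 * (n + 1)) := by
    rw [pow_mul]
    positivity
  rw [centralBinomTerm_eq, Real.norm_of_nonneg (by positivity)]
  calc _ ≤ (2 * ((n + 1 : ℕ) : ℝ)) * (s ^ 2) ^ (n + 1) := by
        gcongr
        exact (div_le_self h2 h1).trans h3
    _ = _ := by ring

lemma summable_centralBinom_bound {s : ℝ} (hs0 : 0 ≤ s) (hs : s < 1) :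
    Summable fun n : ℕ => 2 * (((n + 1 : ℕ) : ℝ) ^ 1 * (s ^ 2) ^ (n + 1)) := by
  have h : ‖s ^ 2‖ < 1 := by
    rw [Real.norm_of_nonneg (by positivity)]
    exact pow_lt_one₀ hs0 hs two_ne_zero
  have hsum : Summable fun n : ℕ => (n : ℝ) ^ 1 * (s ^ 2) ^ n :=
    summable_pow_mul_geometric_of_norm_lt_one 1 h
  exact ((summable_nat_add_iff (f := fun n : ℕ => (n : ℝ) ^ 1 * (s ^ 2) ^ n) 1).mpr
    hsum).mul_left 2

lemma sin_mem_Ioo {z : ℝ} (h0 : 0 < z) (h1 : z < Real.pi / 2) :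
    0 < Real.sin z ∧ Real.sin z < 1 := by
  refine ⟨Real.sin_pos_of_pos_of_lt_pi h0 (by linarith [Real.pi_pos]), ?_⟩
  rw [← Real.sin_pi_div_two]
  exact Real.sin_lt_sin_of_lt_of_le_pi_div_two (by linarith [Real.pi_pos]) le_rfl h1

lemma summable_centralBinomTerm (m : ℕ) {z : ℝ} (h0 : 0 < z) (h1 : z < Real.pi / 2) :
    Summable fun n => centralBinomTerm m n z := by
  obtain ⟨hs0, hs1⟩ := sin_mem_Ioo h0 h1
  exact Summable.of_norm_bounded (summable_centralBinom_bound hs0.le hs1)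
    fun n => norm_centralBinomTerm_le m n (abs_of_pos hs0).le

lemma hasDerivAt_centralBinomTerm (m n : ℕ) {z : ℝ} (hz : Real.sin z ≠ 0) :
    HasDerivAt (centralBinomTerm (m + 1) n)
      (2 * (Real.cos z / Real.sin z) * centralBinomTerm m n z) z := by
  have heq : centralBinomTerm (m + 1) n = fun z =>
      fourPowDivCentralBinom (n + 1) / ((n : ℝ) + 1) ^ (m + 1) * Real.sin z ^ (2 * (n + 1)) :=
    funext fun z => centralBinomTerm_eq _ _ _
  rw [heq, centralBinomTerm_eq]
  refine (((Real.hasDerivAt_sin z).pow (2 * (n + 1))).const_mul _).congr_deriv ?_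
  have hn : ((n : ℝ) + 1) ≠ 0 := by positivity
  rw [show 2 * (n + 1) - 1 = 2 * n + 1 by omega, show 2 * (n + 1) = 2 * n + 1 + 1 by ring]
  push_cast
  field_simp
  ring

lemma hasDerivAt_centralBinomSum (m : ℕ) {z : ℝ} (h0 : 0 < z) (h1 : z < Real.pi / 2) :
    HasDerivAt (centralBinomSum (m + 1))
      (2 * (Real.cos z / Real.sin z) * centralBinomSum m z) z := by
  obtain ⟨a, ha0, ha⟩ := exists_between h0
  obtain ⟨b, hb, hb1⟩ := exists_between h1
  obtain ⟨hsa, -⟩ := sin_mem_Ioo ha0 (ha.trans h1)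
  obtain ⟨hsb, hsb1⟩ := sin_mem_Ioo (h0.trans hb) hb1
  have hz : z ∈ Set.Ioo a b := ⟨ha, hb⟩
  have hlow : ∀ y ∈ Set.Ioo a b, Real.sin a ≤ Real.sin y := fun y hy =>
    Real.sin_le_sin_of_le_of_le_pi_div_two (by linarith [Real.pi_pos]) (hy.2.trans hb1).le hy.1.le
  have hup : ∀ y ∈ Set.Ioo a b, Real.sin y ≤ Real.sin b := fun y hy =>
    Real.sin_le_sin_of_le_of_le_pi_div_two (by linarith [Real.pi_pos, hy.1]) hb1.le hy.2.le
  unfold centralBinomSum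
  rw [← tsum_mul_left]
  refine hasDerivAt_tsum_of_isPreconnected (t := Set.Ioo a b) (y₀ := z)
    (g := fun n y => centralBinomTerm (m + 1) n y)
    (g' := fun n y => 2 * (Real.cos y / Real.sin y) * centralBinomTerm m n y)
    ((summable_centralBinom_bound hsb.le hsb1).mul_left (2 * (1 / Real.sin a)))
    isOpen_Ioo isPreconnected_Ioo
    (fun n y hy => hasDerivAt_centralBinomTerm m n (hsa.trans_le (hlow y hy)).ne') ?_ hz
    (summable_centralBinomTerm _ h0 h1) hz
  intro n y hy
  have hsy : 0 < Real.sin y := hsa.trans_le (hlow y hy)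
  rw [norm_mul, norm_mul, norm_div, Real.norm_ofNat, Real.norm_of_nonneg hsy.le]
  gcongr
  · exact Real.abs_cos_le_one y
  · exact hlow y hy
  · exact norm_centralBinomTerm_le m n (by rw [abs_of_pos hsy]; exact hup y hy)

lemma tendsto_centralBinomSum (m : ℕ) : Tendsto (centralBinomSum m) (𝓝[>] 0) (𝓝 0) := by
  have hpi := Real.pi_gt_three
  obtain ⟨hs0, hs1⟩ := sin_mem_Ioo one_pos (by linarith : (1 : ℝ) < Real.pi / 2)
  have hcont : ContinuousOn (centralBinomSum m) (Set.Icc (-1) 1) := by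
    refine continuousOn_tsum (fun n => ?_) (summable_centralBinom_bound hs0.le hs1)
      fun n x hx => norm_centralBinomTerm_le m n ?_
    · unfold centralBinomTerm
      fun_prop
    · rw [abs_le, ← Real.sin_neg]
      exact ⟨Real.sin_le_sin_of_le_of_le_pi_div_two (by linarith) (by linarith [hx.2]) hx.1,
        Real.sin_le_sin_of_le_of_le_pi_div_two (by linarith [hx.1]) (by linarith) hx.2⟩
  have h := (hcont.continuousAt (Icc_mem_nhds (by norm_num : (-1 : ℝ) < 0) one_pos)).tendsto
  have hz : centralBinomSum m 0 = 0 := by simp [centralBinomSum, centralBinomTerm]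
  rw [hz] at h
  exact h.mono_left nhdsWithin_le_nhds

/-! ### Evaluation of the series of weight two -/

/-- Remainder estimate for `2 z² = ∑_{n ≥ 1} (2 sin z)^{2n} / (n² (2n choose n))`: the second
derivative of the remainder telescopes. -/
lemma abs_sum_centralBinomTerm_two_sub_le (N : ℕ) {z : ℝ} (h0 : 0 ≤ z) (h1 : z ≤ Real.pi / 2) :
    |(∑ n ∈ Finset.range N, centralBinomTerm 2 n z) - 2 * z ^ 2| ≤
      4 * fourPowDivCentralBinom N * Real.sin z ^ (2 * N) * z * z := by
  set r := fourPowDivCentralBinom with hr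
  set ε := 4 * r N * Real.sin z ^ (2 * N) with hε
  let E' : ℝ → ℝ := fun t => (∑ n ∈ Finset.range N,
    r (n + 1) / ((n : ℝ) + 1) ^ 2 * ((2 * n + 2) * (Real.sin t ^ (2 * n + 1) * Real.cos t))) - 4 * t
  have hE : ∀ t, HasDerivAt
      (fun t => (∑ n ∈ Finset.range N, centralBinomTerm 2 n t) - 2 * t ^ 2) (E' t) t := by
    intro t
    simp only [centralBinomTerm_eq]
    refine HasDerivAt.sub (HasDerivAt.fun_sum fun n _ => ?_) ?_
    · refine (((Real.hasDerivAt_sin t).pow (2 * (n + 1))).const_mul _).congr_deriv ?_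
      rw [show 2 * (n + 1) - 1 = 2 * n + 1 by omega]
      push_cast
      ring
    · exact ((hasDerivAt_pow 2 t).const_mul 2).congr_deriv (by push_cast; ring)
  have hE' : ∀ t, HasDerivAt E' (-(4 * r N * Real.sin t ^ (2 * N))) t := by
    intro t
    -- By the recurrence for r, the n-th term has second derivative 4 r_n sin^{2n} - 4 r_{n+1}
    -- sin^{2n+2}. As r_0 = 1, the telescoped sum begins with 4, which the second derivative of 2t²
    -- cancels.
    have hsum : ∀ M : ℕ, (∑ n ∈ Finset.range M, (4 * r n * Real.sin t ^ (2 * n) -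
        4 * r (n + 1) * Real.sin t ^ (2 * (n + 1)))) = 4 - 4 * r M * Real.sin t ^ (2 * M) := by
      intro M
      rw [Finset.sum_range_sub' (fun n => 4 * r n * Real.sin t ^ (2 * n))]
      simp [hr, fourPowDivCentralBinom]
    have : -(4 * r N * Real.sin t ^ (2 * N)) =
        (4 - 4 * r N * Real.sin t ^ (2 * N)) - 4 := by ring
    rw [this, ← hsum]
    refine HasDerivAt.sub (HasDerivAt.fun_sum fun n _ => ?_) ?_
    · refine (((((Real.hasDerivAt_sin t).pow (2 * n + 1)).mul
        (Real.hasDerivAt_cos t)).const_mul _).const_mul _).congr_deriv ?_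
      have hrec : (2 * n + 1) * r (n + 1) = 2 * (n + 1) * r n := fourPowDivCentralBinom_succ n
      have hn : ((n : ℝ) + 1) ≠ 0 := by positivity
      have hrn : r n = (2 * n + 1) * r (n + 1) / (2 * (n + 1)) := by
        rw [hrec]
        field_simp
      have hcs : Real.cos t ^ 2 = 1 - Real.sin t ^ 2 := Real.cos_sq' t
      rw [Nat.add_sub_cancel, show 2 * (n + 1) = 2 * n + 1 + 1 by ring]
      push_cast
      rw [Pi.pow_apply, hrn]
      field_simp
      rw [hcs]
      ring
    · simpa using (hasDerivAt_id t).const_mul 4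
  have hb' : ∀ t ∈ Set.Icc 0 z, ‖-(4 * r N * Real.sin t ^ (2 * N))‖ ≤ ε := by
    intro t ht
    have hst : 0 ≤ Real.sin t :=
      Real.sin_nonneg_of_nonneg_of_le_pi ht.1 (by linarith [ht.2, Real.pi_pos])
    have hr0 : 0 ≤ r N := fourPowDivCentralBinom_nonneg N
    rw [norm_neg, Real.norm_of_nonneg (by positivity), hε]
    gcongr
    exact Real.sin_le_sin_of_le_of_le_pi_div_two (by linarith [ht.1, Real.pi_pos]) h1 ht.2
  have hε0 : 0 ≤ ε := (norm_nonneg _).trans (hb' 0 ⟨le_rfl, h0⟩)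
  have hb : ∀ t ∈ Set.Icc 0 z, ‖E' t‖ ≤ ε * z := by
    intro t ht
    -- The mean value inequality is applied twice, to `E'` here and to the remainder below; both
    -- vanish at 0.
    have h := (convex_Icc 0 z).norm_image_sub_le_of_norm_hasDerivWithin_le
      (fun x _ => (hE' x).hasDerivWithinAt) hb' ⟨le_rfl, h0⟩ ht
    have hE0 : E' 0 = 0 := by simp [E']
    rw [hE0, sub_zero, sub_zero, Real.norm_of_nonneg ht.1] at h
    exact h.trans (mul_le_mul_of_nonneg_left ht.2 hε0)
  have h := (convex_Icc 0 z).norm_image_sub_le_of_norm_hasDerivWithin_le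
    (fun x _ => (hE x).hasDerivWithinAt) hb ⟨le_rfl, h0⟩ ⟨h0, le_rfl⟩
  have hE0 : (∑ n ∈ Finset.range N, centralBinomTerm 2 n 0) = 0 :=
    Finset.sum_eq_zero fun n _ => by simp [centralBinomTerm]
  simpa [hE0, abs_of_nonneg h0] using h

lemma centralBinomSum_two {z : ℝ} (h0 : 0 < z) (h1 : z < Real.pi / 2) :
    centralBinomSum 2 z = 2 * z ^ 2 := by
  obtain ⟨hs0, hs1⟩ := sin_mem_Ioo h0 h1
  refine tendsto_nhds_unique (summable_centralBinomTerm 2 h0 h1).hasSum.tendsto_sum_nat ?_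
  rw [tendsto_iff_norm_sub_tendsto_zero]
  have hlim : Tendsto (fun N : ℕ => 4 * (2 * ((N : ℝ) ^ 1 * (Real.sin z ^ 2) ^ N)) * z * z)
      atTop (𝓝 0) := by
    have := tendsto_pow_const_mul_const_pow_of_lt_one 1 (r := Real.sin z ^ 2) (by positivity)
      (pow_lt_one₀ hs0.le hs1 two_ne_zero)
    simpa using (((this.const_mul 2).const_mul 4).mul_const z).mul_const z
  refine squeeze_zero' (Eventually.of_forall fun N => norm_nonneg _) ?_ hlim
  filter_upwards [eventually_gt_atTop 0] with N hN
  refine (abs_sum_centralBinomTerm_two_sub_le N h0.le h1.le).trans ?_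
  have := fourPowDivCentralBinom_le hN
  rw [pow_mul, pow_one, ← mul_assoc 2, mul_assoc 4]
  gcongr

/-! ### Log-sine integrals and their differential equation -/

lemma abs_mul_log_sin_div_pow_le (p : ℕ) {t z : ℝ} (ht : 0 < t) (htz : t ≤ z)
    (hz : z ≤ Real.pi / 2) :
    |t * Real.log (Real.sin t / Real.sin z) ^ p| ≤ Real.pi / 2 * p.factorial * Real.sin z := by
  have hpi := Real.pi_pos
  have hst : 0 < Real.sin t := Real.sin_pos_of_pos_of_lt_pi ht (by linarith)
  have hsz : 0 < Real.sin z := Real.sin_pos_of_pos_of_lt_pi (ht.trans_le htz) (by linarith)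
  have hle : Real.sin t ≤ Real.sin z :=
    Real.sin_le_sin_of_le_of_le_pi_div_two (by linarith) hz htz
  have htsin : t ≤ Real.pi / 2 * Real.sin t := by
    have h := Real.mul_le_sin ht.le (htz.trans hz)
    calc t = Real.pi / 2 * (2 / Real.pi * t) := by field_simp
      _ ≤ _ := by gcongr
  set y := Real.sin t / Real.sin z with hy
  have hy0 : 0 < y := div_pos hst hsz
  have hlog : Real.log y ≤ 0 := Real.log_nonpos hy0.le ((div_le_one hsz).mpr hle)
  -- With w = -log y ≥ 0, the inequality w^p / p! ≤ e^w = 1/y gives y w^p ≤ p!. Jordan's inequality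
  -- t ≤ (π/2) sin t supplies the factor y.
  have h := Real.pow_div_factorial_le_exp (-Real.log y) (by linarith) p
  rw [Real.exp_neg, Real.exp_log hy0, div_le_iff₀ (by positivity), inv_mul_eq_div,
    le_div_iff₀ hy0] at h
  have hsy : Real.sin t = y * Real.sin z := by rw [hy]; field_simp
  rw [abs_mul, abs_of_pos ht, abs_pow, abs_of_nonpos hlog]
  have hw : 0 ≤ (-Real.log y) ^ p := pow_nonneg (by linarith) p
  calc t * (-Real.log y) ^ p ≤ Real.pi / 2 * (y * Real.sin z) * (-Real.log y) ^ p := by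
        rw [← hsy]
        gcongr
    _ = Real.pi / 2 * ((-Real.log y) ^ p * y) * Real.sin z := by ring
    _ ≤ _ := by gcongr

lemma intervalIntegrable_mul_log_sin_div_pow (p : ℕ) {b z : ℝ} (hb : 0 ≤ b) (hbz : b ≤ z)
    (hz : z ≤ Real.pi / 2) :
    IntervalIntegrable (fun t => t * Real.log (Real.sin t / Real.sin z) ^ p) volume 0 b := by
  rw [intervalIntegrable_iff_integrableOn_Ioc_of_le hb]
  refine Measure.integrableOn_of_bounded (M := Real.pi / 2 * p.factorial * Real.sin z)
    measure_Ioc_lt_top.ne (Measurable.aestronglyMeasurable (by fun_prop)) ?_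
  filter_upwards [ae_restrict_mem measurableSet_Ioc] with t ht
  exact abs_mul_log_sin_div_pow_le p ht.1 (ht.2.trans hbz) hz

/-- The moment `∫_0^z t log^j (sin t) dt`. -/
noncomputable def logSinMoment (j : ℕ) (z : ℝ) : ℝ := ∫ t in (0 : ℝ)..z, t * Real.log (Real.sin t) ^ j

lemma intervalIntegrable_mul_log_sin_pow (j : ℕ) {z : ℝ} (h0 : 0 ≤ z) (h1 : z ≤ Real.pi / 2) :
    IntervalIntegrable (fun t => t * Real.log (Real.sin t) ^ j) volume 0 z := by
  simpa using intervalIntegrable_mul_log_sin_div_pow j h0 h1 le_rfl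

lemma hasDerivAt_logSinMoment (j : ℕ) {z : ℝ} (h0 : 0 < z) (h1 : z < Real.pi / 2) :
    HasDerivAt (logSinMoment j) (z * Real.log (Real.sin z) ^ j) z := by
  have hs : Real.sin z ≠ 0 := (sin_mem_Ioo h0 h1).1.ne'
  refine intervalIntegral.integral_hasDerivAt_right
    (intervalIntegrable_mul_log_sin_pow j h0.le h1.le) ?_ ?_
  · exact (Measurable.stronglyMeasurable (by fun_prop)).stronglyMeasurableAtFilter
  · fun_prop (disch := exact hs)

/-- The integral `∫_0^z t log^p (sin t / sin z) dt`. -/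
noncomputable def logSinRatioIntegral (p : ℕ) (z : ℝ) : ℝ :=
  ∫ t in (0 : ℝ)..z, t * Real.log (Real.sin t / Real.sin z) ^ p

/-- The parameter z occurs both in the integrand and as endpoint. Expanding (log sin t - log sin
z)^p moves it out of the integrand, so differentiation needs only the product rule and the
fundamental theorem of calculus. -/
lemma logSinRatioIntegral_eq_sum (p : ℕ) {z : ℝ} (h0 : 0 < z) (h1 : z < Real.pi / 2) :
    logSinRatioIntegral p z = ∑ j ∈ Finset.range (p + 1),
      (p.choose j : ℝ) * ((-Real.log (Real.sin z)) ^ (p - j) * logSinMoment j z) := by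
  have hs : 0 < Real.sin z := (sin_mem_Ioo h0 h1).1
  have hcongr : logSinRatioIntegral p z = ∫ t in (0 : ℝ)..z, ∑ j ∈ Finset.range (p + 1),
      ((p.choose j : ℝ) * (-Real.log (Real.sin z)) ^ (p - j)) *
        (t * Real.log (Real.sin t) ^ j) := by
    refine intervalIntegral.integral_congr_ae (Eventually.of_forall fun t ht => ?_)
    rw [Set.uIoc_of_le h0.le] at ht
    have hst : 0 < Real.sin t := (sin_mem_Ioo ht.1 (ht.2.trans_lt h1)).1
    rw [Real.log_div hst.ne' hs.ne', sub_eq_add_neg, add_pow, Finset.mul_sum]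
    exact Finset.sum_congr rfl fun j _ => by ring
  rw [hcongr, intervalIntegral.integral_finsetSum fun j _ =>
    (intervalIntegrable_mul_log_sin_pow j h0.le h1.le).const_mul _]
  refine Finset.sum_congr rfl fun j _ => ?_
  rw [intervalIntegral.integral_const_mul, logSinMoment, mul_assoc]

lemma logSinRatioIntegral_zero (z : ℝ) : logSinRatioIntegral 0 z = z ^ 2 / 2 := by
  simp [logSinRatioIntegral]

lemma hasDerivAt_logSinRatioIntegral (p : ℕ) {z : ℝ} (h0 : 0 < z) (h1 : z < Real.pi / 2) :
    HasDerivAt (logSinRatioIntegral (p + 1))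
      (-(p + 1) * (Real.cos z / Real.sin z) * logSinRatioIntegral p z) z := by
  have hs : Real.sin z ≠ 0 := (sin_mem_Ioo h0 h1).1.ne'
  set L := Real.log (Real.sin z) with hL
  set c := Real.cos z / Real.sin z with hc
  have heq : logSinRatioIntegral (p + 1) =ᶠ[𝓝 z] fun z => ∑ j ∈ Finset.range (p + 1 + 1),
      ((p + 1).choose j : ℝ) *
        ((-Real.log (Real.sin z)) ^ (p + 1 - j) * logSinMoment j z) := by
    filter_upwards [Ioo_mem_nhds h0 h1] with y hy
    exact logSinRatioIntegral_eq_sum (p + 1) hy.1 hy.2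
  refine HasDerivAt.congr_of_eventuallyEq ?_ heq
  have hderiv := HasDerivAt.fun_sum fun j (_ : j ∈ Finset.range (p + 1 + 1)) =>
    (((((Real.hasDerivAt_sin z).log hs).fun_neg.fun_pow (p + 1 - j)).mul
      (hasDerivAt_logSinMoment j h0 h1)).const_mul ((p + 1).choose j : ℝ))
  refine hderiv.congr_deriv ?_
  simp only [mul_add, Finset.sum_add_distrib, ← hL, ← hc]
  -- The endpoint contributions add up to z (L - L)^{p+1} = 0.
  have h2 : ∑ j ∈ Finset.range (p + 1 + 1),
      ((p + 1).choose j : ℝ) * ((-L) ^ (p + 1 - j) * (z * L ^ j)) = 0 := by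
    have h := add_pow L (-L) (p + 1)
    rw [add_neg_cancel, zero_pow p.succ_ne_zero] at h
    rw [← mul_zero z, h, Finset.mul_sum]
    exact Finset.sum_congr rfl fun j _ => by ring
  rw [h2, add_zero, Finset.sum_range_succ, logSinRatioIntegral_eq_sum p h0 h1, Finset.mul_sum]
  simp only [Nat.sub_self, Nat.cast_zero, zero_mul, mul_zero, add_zero]
  refine Finset.sum_congr rfl fun j hj => ?_
  have hjp : j ≤ p := Nat.lt_succ_iff.mp (Finset.mem_range.mp hj)
  have hch : ((p + 1).choose j : ℝ) * ((p + 1 - j : ℕ) : ℝ) = (p + 1) * (p.choose j : ℝ) := by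
    have := Nat.choose_mul_succ_eq p j
    rw [mul_comm ((p : ℝ) + 1)]
    exact_mod_cast this.symm
  rw [show p + 1 - j - 1 = p - j by omega]
  linear_combination (-c * (-L) ^ (p - j) * logSinMoment j z) * hch

lemma tendsto_logSinRatioIntegral (p : ℕ) :
    Tendsto (logSinRatioIntegral p) (𝓝[>] 0) (𝓝 0) := by
  have hpi := Real.pi_gt_three
  have hlim : Tendsto (fun z : ℝ => Real.pi / 2 * p.factorial * z) (𝓝[>] 0) (𝓝 0) := by
    have : Tendsto (fun z : ℝ => Real.pi / 2 * p.factorial * z) (𝓝 0) (𝓝 _) :=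
      Continuous.tendsto (by fun_prop) 0
    rw [mul_zero] at this
    exact this.mono_left nhdsWithin_le_nhds
  refine squeeze_zero_norm' ?_ hlim
  filter_upwards [Ioo_mem_nhdsGT one_pos] with z hz
  have hsz : Real.sin z ≤ 1 := Real.sin_le_one z
  have h := intervalIntegral.norm_integral_le_of_norm_le_const (a := 0) (b := z)
    (f := fun t => t * Real.log (Real.sin t / Real.sin z) ^ p)
    (C := Real.pi / 2 * p.factorial * Real.sin z) fun t ht => by
      rw [Set.uIoc_of_le hz.1.le] at ht
      exact abs_mul_log_sin_div_pow_le p ht.1 ht.2 (by linarith [hz.2])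
  rw [sub_zero, abs_of_pos hz.1] at h
  refine h.trans ?_
  have : 0 < z := hz.1
  have h' : Real.pi / 2 * p.factorial * Real.sin z ≤ Real.pi / 2 * p.factorial * 1 := by gcongr
  calc _ ≤ Real.pi / 2 * p.factorial * 1 * z := by gcongr
    _ = _ := by ring

lemma normLogSine_one (p : ℕ) (z : ℝ) :
    normLogSine (p + 2) 1 z = -logSinRatioIntegral p z := by
  simp [normLogSine, logSinRatioIntegral]

/-! ### Comparison of integrals and series by derivative and limit at 0 -/

/-- A function on `(0, b)` with zero derivative and limit zero at `0` vanishes. -/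
lemma eq_zero_of_hasDerivAt_zero {f : ℝ → ℝ} {b : ℝ}
    (hf : ∀ z, 0 < z → z < b → HasDerivAt f 0 z) (hlim : Tendsto f (𝓝[>] 0) (𝓝 0))
    {z : ℝ} (h0 : 0 < z) (h1 : z < b) : f z = 0 := by
  have hconst : ∀ y ∈ Set.Ioo 0 b, f y = f z := fun y hy =>
    isOpen_Ioo.is_const_of_deriv_eq_zero isPreconnected_Ioo
      (fun x hx => (hf x hx.1 hx.2).differentiableAt.differentiableWithinAt)
      (fun x hx => (hf x hx.1 hx.2).deriv) hy ⟨h0, h1⟩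
  have h : Tendsto f (𝓝[>] 0) (𝓝 (f z)) :=
    tendsto_const_nhds.congr' (by
      filter_upwards [Ioo_mem_nhdsGT (h0.trans h1)] with y hy
      exact (hconst y hy).symm)
  exact tendsto_nhds_unique h hlim

/-- Two functions on `(0, b)` with equal derivatives and limit zero at `0` agree. -/
lemma eq_of_hasDerivAt_eq {f g f' g' : ℝ → ℝ} {b : ℝ}
    (hf : ∀ z, 0 < z → z < b → HasDerivAt f (f' z) z)
    (hg : ∀ z, 0 < z → z < b → HasDerivAt g (g' z) z)
    (heq : ∀ z, 0 < z → z < b → f' z = g' z)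
    (hf0 : Tendsto f (𝓝[>] 0) (𝓝 0)) (hg0 : Tendsto g (𝓝[>] 0) (𝓝 0))
    {z : ℝ} (h0 : 0 < z) (h1 : z < b) : f z = g z := by
  refine sub_eq_zero.mp (eq_zero_of_hasDerivAt_zero (f := fun z => f z - g z)
    (fun y hy0 hy1 => ?_) (by simpa using hf0.sub hg0) h0 h1)
  exact ((hf y hy0 hy1).sub (hg y hy0 hy1)).congr_deriv (by rw [heq y hy0 hy1, sub_self])

/-- `∫_0^z t log^p (sin t / sin z) dt` as a central binomial series. -/
lemma logSinRatioIntegral_eq_centralBinomSum (p : ℕ) {z : ℝ} (h0 : 0 < z)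
    (h1 : z < Real.pi / 2) :
    logSinRatioIntegral p z =
      (-1) ^ p * p.factorial / 2 ^ (p + 2) * centralBinomSum (p + 2) z := by
  induction p generalizing z with
  | zero =>
    rw [logSinRatioIntegral_zero, centralBinomSum_two h0 h1]
    norm_num
    ring
  | succ p ih =>
    refine eq_of_hasDerivAt_eq (fun y hy0 hy1 => hasDerivAt_logSinRatioIntegral p hy0 hy1)
      (fun y hy0 hy1 => (hasDerivAt_centralBinomSum (p + 2) hy0 hy1).const_mul _)
      (fun y hy0 hy1 => ?_) (tendsto_logSinRatioIntegral (p + 1)) ?_ h0 h1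
    · rw [ih hy0 hy1, Nat.factorial_succ]
      push_cast
      field_simp
      ring
    · simpa using (tendsto_centralBinomSum (p + 1 + 2)).const_mul
        ((-1 : ℝ) ^ (p + 1) * (p + 1).factorial / 2 ^ (p + 1 + 2))

/-! ### Polylogarithms along the arc u = e^{-2iz} -/

/-- `Li_m (e^{-2iz})` as a function of the real variable `z`. -/
noncomputable def polylogArc (m : ℕ) (z : ℝ) : ℂ :=
  polylog m (Complex.exp (-2 * Complex.I * (z : ℂ)))

/-- `Li_m (1 - e^{-2iz})` as a function of the real variable `z`. -/
noncomputable def polylogOneSubArc (m : ℕ) (z : ℝ) : ℂ :=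
  polylog m (1 - Complex.exp (-2 * Complex.I * (z : ℂ)))

lemma exp_neg_two_I_mul (z : ℝ) : Complex.exp (-2 * Complex.I * (z : ℂ)) =
    ⟨Real.cos (2 * z), -Real.sin (2 * z)⟩ := by
  have h : -2 * Complex.I * (z : ℂ) = ((-(2 * z) : ℝ) : ℂ) * Complex.I := by push_cast; ring
  rw [h]
  apply Complex.ext
  · rw [Complex.exp_ofReal_mul_I_re, Real.cos_neg]
  · rw [Complex.exp_ofReal_mul_I_im, Real.sin_neg]

lemma one_sub_exp_neg_two_I_mul (z : ℝ) : 1 - Complex.exp (-2 * Complex.I * (z : ℂ)) =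
    ⟨2 * Real.sin z * Real.sin z, 2 * Real.sin z * Real.cos z⟩ := by
  rw [exp_neg_two_I_mul]
  apply Complex.ext
  · simp only [Complex.sub_re, Complex.one_re, Real.cos_two_mul]
    linear_combination (-2) * Real.sin_sq_add_cos_sq z
  · simp [Real.sin_two_mul]

lemma norm_one_sub_exp_neg_two_I_mul {z : ℝ} (hz : 0 < Real.sin z) :
    ‖1 - Complex.exp (-2 * Complex.I * (z : ℂ))‖ = 2 * Real.sin z := by
  have h : 2 * Real.sin z * Real.sin z * (2 * Real.sin z * Real.sin z) +
      2 * Real.sin z * Real.cos z * (2 * Real.sin z * Real.cos z) = (2 * Real.sin z) ^ 2 := by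
    linear_combination (2 * Real.sin z) ^ 2 * Real.sin_sq_add_cos_sq z
  rw [one_sub_exp_neg_two_I_mul, Complex.norm_def, Complex.normSq_mk, h,
    Real.sqrt_sq (by positivity)]

lemma exp_mem_polylogDomain {z : ℝ} (h0 : 0 < z) (h1 : z < Real.pi / 2) :
    Complex.exp (-2 * Complex.I * (z : ℂ)) ∈ polylogDomain := by
  obtain ⟨hs, -⟩ := sin_mem_Ioo h0 h1
  rw [mem_polylogDomain, one_sub_exp_neg_two_I_mul]
  left
  change 0 < 2 * Real.sin z * Real.sin z
  positivity

lemma one_sub_exp_mem_polylogDomain {z : ℝ} (h0 : 0 < z) (h1 : z < Real.pi / 2) :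
    1 - Complex.exp (-2 * Complex.I * (z : ℂ)) ∈ polylogDomain := by
  rw [mem_polylogDomain, sub_sub_cancel, exp_neg_two_I_mul]
  right
  change -Real.sin (2 * z) ≠ 0
  have : 0 < Real.sin (2 * z) := Real.sin_pos_of_pos_of_lt_pi (by linarith) (by linarith)
  linarith

lemma hasDerivAt_exp_neg_two_I_mul (w : ℂ) :
    HasDerivAt (fun w : ℂ => Complex.exp (-2 * Complex.I * w))
      (-2 * Complex.I * Complex.exp (-2 * Complex.I * w)) w :=
  (((hasDerivAt_id w).const_mul (-2 * Complex.I)).cexp).congr_deriv (by simp; ring)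

lemma hasDerivAt_polylogArc (m : ℕ) {z : ℝ} (h0 : 0 < z) (h1 : z < Real.pi / 2) :
    HasDerivAt (polylogArc (m + 1)) (-2 * Complex.I * polylogArc m z) z := by
  have hne := Complex.exp_ne_zero (-2 * Complex.I * (z : ℂ))
  have h := ((hasDerivAt_polylog m (exp_mem_polylogDomain h0 h1) hne).comp (z : ℂ)
    (hasDerivAt_exp_neg_two_I_mul z)).comp_ofReal
  refine h.congr_deriv ?_
  rw [polylogArc]
  field_simp

lemma hasDerivAt_polylogOneSubArc (m : ℕ) {z : ℝ} (h0 : 0 < z) (h1 : z < Real.pi / 2) :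
    HasDerivAt (polylogOneSubArc (m + 1))
      (((Real.cos z / Real.sin z : ℝ) - Complex.I) * polylogOneSubArc m z) z := by
  obtain ⟨hs, -⟩ := sin_mem_Ioo h0 h1
  have hne : 1 - Complex.exp (-2 * Complex.I * (z : ℂ)) ≠ 0 := by
    rw [← norm_pos_iff, norm_one_sub_exp_neg_two_I_mul hs]
    positivity
  have h := ((hasDerivAt_polylog m (one_sub_exp_mem_polylogDomain h0 h1) hne).comp (z : ℂ)
    ((hasDerivAt_exp_neg_two_I_mul z).const_sub 1)).comp_ofReal
  refine h.congr_deriv ?_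
  obtain ⟨c, hc⟩ : ∃ c, c = Real.cos z / Real.sin z := ⟨_, rfl⟩
  have hcs : c * Real.sin z = Real.cos z := by rw [hc, div_mul_cancel₀ _ hs.ne']
  -- The chain rule yields 2iu/(1-u) times Li_m(1-u), and 2iu/(1-u) = cot z - i.
  have key : -(-2 * Complex.I * Complex.exp (-2 * Complex.I * (z : ℂ))) =
      ((c : ℂ) - Complex.I) * (1 - Complex.exp (-2 * Complex.I * (z : ℂ))) := by
    rw [one_sub_exp_neg_two_I_mul, exp_neg_two_I_mul]
    apply Complex.ext
    · simp [Real.sin_two_mul]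
      linear_combination (-2 * Real.sin z) * hcs
    · simp [Real.cos_two_mul]
      linear_combination (-2 * Real.cos z) * hcs + 2 * Real.sin_sq_add_cos_sq z
  rw [polylogOneSubArc, key, ← hc, mul_comm, mul_assoc, mul_div_cancel₀ _ hne]

lemma HasDerivAt.complex_re {f : ℝ → ℂ} {f' : ℂ} {z : ℝ} (h : HasDerivAt f f' z) :
    HasDerivAt (fun z => (f z).re) f'.re z :=
  Complex.reCLM.hasFDerivAt.comp_hasDerivAt z h

lemma HasDerivAt.complex_im {f : ℝ → ℂ} {f' : ℂ} {z : ℝ} (h : HasDerivAt f f' z) :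
    HasDerivAt (fun z => (f z).im) f'.im z :=
  Complex.imCLM.hasFDerivAt.comp_hasDerivAt z h

lemma hasDerivAt_polylogArc_re (m : ℕ) {z : ℝ} (h0 : 0 < z) (h1 : z < Real.pi / 2) :
    HasDerivAt (fun z => (polylogArc (m + 1) z).re) (2 * (polylogArc m z).im) z :=
  (hasDerivAt_polylogArc m h0 h1).complex_re.congr_deriv (by simp)

lemma hasDerivAt_polylogArc_im (m : ℕ) {z : ℝ} (h0 : 0 < z) (h1 : z < Real.pi / 2) :
    HasDerivAt (fun z => (polylogArc (m + 1) z).im) (-2 * (polylogArc m z).re) z :=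
  (hasDerivAt_polylogArc m h0 h1).complex_im.congr_deriv (by simp)

lemma hasDerivAt_polylogOneSubArc_re (m : ℕ) {z : ℝ} (h0 : 0 < z) (h1 : z < Real.pi / 2) :
    HasDerivAt (fun z => (polylogOneSubArc (m + 1) z).re)
      (Real.cos z / Real.sin z * (polylogOneSubArc m z).re + (polylogOneSubArc m z).im) z := by
  refine (hasDerivAt_polylogOneSubArc m h0 h1).complex_re.congr_deriv ?_
  rw [sub_mul, Complex.sub_re, Complex.re_ofReal_mul, Complex.I_mul_re, sub_neg_eq_add]

lemma hasDerivAt_polylogOneSubArc_im (m : ℕ) {z : ℝ} (h0 : 0 < z) (h1 : z < Real.pi / 2) :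
    HasDerivAt (fun z => (polylogOneSubArc (m + 1) z).im)
      (Real.cos z / Real.sin z * (polylogOneSubArc m z).im - (polylogOneSubArc m z).re) z := by
  refine (hasDerivAt_polylogOneSubArc m h0 h1).complex_im.congr_deriv ?_
  rw [sub_mul, Complex.sub_im, Complex.im_ofReal_mul, Complex.I_mul_im]

/-- The principal logarithm of u is -2iz because -2z lies in (-π, 0). -/
lemma polylogOneSubArc_one {z : ℝ} (h0 : 0 < z) (h1 : z < Real.pi / 2) :
    polylogOneSubArc 1 z = (2 * z : ℝ) * Complex.I := by
  rw [polylogOneSubArc, polylog_one_eq_neg_log (one_sub_exp_mem_polylogDomain h0 h1),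
    sub_sub_cancel, Complex.log_exp]
  · push_cast
    ring
  · simp
    linarith
  · simp
    linarith

lemma polylogArc_one_re {z : ℝ} (h0 : 0 < z) (h1 : z < Real.pi / 2) :
    (polylogArc 1 z).re = -Real.log (2 * Real.sin z) := by
  rw [polylogArc, polylog_one_eq_neg_log (exp_mem_polylogDomain h0 h1), Complex.neg_re,
    Complex.log_re, norm_one_sub_exp_neg_two_I_mul (sin_mem_Ioo h0 h1).1]

lemma tendsto_polylogOneSubArc (m : ℕ) : Tendsto (polylogOneSubArc m) (𝓝[>] 0) (𝓝 0) := by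
  have hpoly : ContinuousAt (polylog m) (1 - Complex.exp (-2 * Complex.I * ((0 : ℝ) : ℂ))) := by
    simpa using (analyticOnNhd_polylog m 0
      (mem_polylogDomain_of_norm_lt_one (by simp))).continuousAt
  have h : ContinuousAt (polylogOneSubArc m) 0 :=
    ContinuousAt.comp (f := fun z : ℝ => 1 - Complex.exp (-2 * Complex.I * (z : ℂ))) hpoly
      (by fun_prop)
  have h0 : polylogOneSubArc m 0 = 0 := by simp [polylogOneSubArc, polylog_zero_right]
  simpa [h0] using h.tendsto.mono_left nhdsWithin_le_nhds

lemma tendsto_polylogArc (m : ℕ) :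
    Tendsto (polylogArc (m + 2)) (𝓝[>] 0) (𝓝 (riemannZeta (m + 2 : ℕ))) := by
  have h : Continuous (polylogArc (m + 2)) := by
    refine (continuousOn_polylog_closedBall m).comp_continuous (by fun_prop) fun z => ?_
    simp [Complex.norm_exp]
  have h0 : polylogArc (m + 2) 0 = riemannZeta (m + 2 : ℕ) := by
    rw [polylogArc, Complex.ofReal_zero, mul_zero, Complex.exp_zero, polylog_one_right]
  rw [← h0]
  exact h.continuousAt.tendsto.mono_left nhdsWithin_le_nhds

lemma tendsto_re_nhds {f : ℝ → ℂ} {l : Filter ℝ} {a : ℂ} (h : Tendsto f l (𝓝 a)) :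
    Tendsto (fun z => (f z).re) l (𝓝 a.re) :=
  (Complex.continuous_re.tendsto a).comp h

lemma tendsto_im_nhds {f : ℝ → ℂ} {l : Filter ℝ} {a : ℂ} (h : Tendsto f l (𝓝 a)) :
    Tendsto (fun z => (f z).im) l (𝓝 a.im) :=
  (Complex.continuous_im.tendsto a).comp h

lemma tendsto_id_nhdsGT_zero : Tendsto (fun z : ℝ => z) (𝓝[>] 0) (𝓝 0) :=
  tendsto_id'.2 nhdsWithin_le_nhds

lemma tendsto_mul_log_two_sin :
    Tendsto (fun z => z * Real.log (2 * Real.sin z)) (𝓝[>] 0) (𝓝 0) := by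
  have hpi := Real.pi_gt_three
  have h : Tendsto (fun z => Real.pi / 4 * ‖2 * Real.sin z * Real.log (2 * Real.sin z)‖)
      (𝓝[>] 0) (𝓝 0) := by
    have hc : Continuous fun z => Real.pi / 4 * ‖2 * Real.sin z * Real.log (2 * Real.sin z)‖ :=
      continuous_const.mul (Real.continuous_mul_log.comp
        (by fun_prop : Continuous fun z => 2 * Real.sin z)).norm
    simpa using (hc.tendsto 0).mono_left nhdsWithin_le_nhds
  refine squeeze_zero_norm' ?_ h
  filter_upwards [Ioo_mem_nhdsGT one_pos] with z hz
  have h2 := Real.mul_le_sin hz.1.le (by linarith [hz.2])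
  have h3 : z ≤ Real.pi / 4 * (2 * Real.sin z) := by
    calc z = Real.pi / 2 * (2 / Real.pi * z) := by field_simp
      _ ≤ Real.pi / 2 * Real.sin z := by gcongr
      _ = _ := by ring
  obtain ⟨hs, -⟩ := sin_mem_Ioo hz.1 (by linarith [hz.2])
  rw [norm_mul, norm_mul, ← mul_assoc, Real.norm_of_nonneg hz.1.le,
    Real.norm_of_nonneg (by positivity : 0 ≤ 2 * Real.sin z)]
  gcongr

lemma hasDerivAt_log_two_sin {z : ℝ} (h0 : 0 < z) (h1 : z < Real.pi / 2) :
    HasDerivAt (fun z => Real.log (2 * Real.sin z)) (Real.cos z / Real.sin z) z := by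
  obtain ⟨hs, -⟩ := sin_mem_Ioo h0 h1
  refine (((Real.hasDerivAt_sin z).const_mul 2).log (by positivity)).congr_deriv ?_
  field_simp

/-! ### Functional equations of weights two and three -/

lemma polylogOneSubArc_two_re {z : ℝ} (h0 : 0 < z) (h1 : z < Real.pi / 2) :
    (polylogOneSubArc 2 z).re = z ^ 2 := by
  refine eq_of_hasDerivAt_eq (fun y hy0 hy1 => hasDerivAt_polylogOneSubArc_re 1 hy0 hy1)
    (fun y _ _ => hasDerivAt_pow 2 y) (fun y hy0 hy1 => ?_)
    (tendsto_re_nhds (tendsto_polylogOneSubArc 2)) ?_ h0 h1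
  · simp [polylogOneSubArc_one hy0 hy1]
  · simpa using tendsto_id_nhdsGT_zero.pow 2

/-- This is the imaginary part of Euler's reflection formula for Li_2(u) + Li_2(1-u); the constant
ζ(2) is real and drops out. -/
lemma polylogArc_two_im_add {z : ℝ} (h0 : 0 < z) (h1 : z < Real.pi / 2) :
    (polylogArc 2 z).im + (polylogOneSubArc 2 z).im = 2 * (z * Real.log (2 * Real.sin z)) := by
  refine eq_of_hasDerivAt_eq
    (fun y hy0 hy1 => (hasDerivAt_polylogArc_im 1 hy0 hy1).add
      (hasDerivAt_polylogOneSubArc_im 1 hy0 hy1))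
    (fun y hy0 hy1 => ((hasDerivAt_id' y).mul (hasDerivAt_log_two_sin hy0 hy1)).const_mul 2)
    (fun y hy0 hy1 => ?_) ?_ ?_ h0 h1
  · rw [polylogArc_one_re hy0 hy1]
    simp [polylogOneSubArc_one hy0 hy1]
    ring
  · have hzeta : (riemannZeta (0 + 2 : ℕ)).im = 0 := by
      rw [zero_add, Nat.cast_ofNat, riemannZeta_two]
      norm_cast
    have h := (tendsto_im_nhds (tendsto_polylogArc 0)).add
      (tendsto_im_nhds (tendsto_polylogOneSubArc 2))
    rwa [hzeta, Complex.zero_im, add_zero] at h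
  · simpa using tendsto_mul_log_two_sin.const_mul 2

/-- This is the real part of Landen's three-term relation for Li_3 at u, 1-u and 1-1/u. On the unit
circle 1-1/u is the conjugate of 1-u, hence the coefficient 2. The derivative vanishes by the
weight-two reflection and Re Li_2(1-u) = z². -/
lemma polylogArc_three_re {z : ℝ} (h0 : 0 < z) (h1 : z < Real.pi / 2) :
    2 * (z * (z * Real.log (2 * Real.sin z))) + (riemannZeta 3).re - (polylogArc 3 z).re -
      2 * (polylogOneSubArc 3 z).re = 0 := by
  refine eq_zero_of_hasDerivAt_zero (f := fun z => 2 * (z * (z * Real.log (2 * Real.sin z))) +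
    (riemannZeta 3).re - (polylogArc 3 z).re - 2 * (polylogOneSubArc 3 z).re)
    (fun y hy0 hy1 => ?_) ?_ h0 h1
  · refine ((((((hasDerivAt_id' y).mul ((hasDerivAt_id' y).mul
      (hasDerivAt_log_two_sin hy0 hy1))).const_mul 2).add_const _).sub
      (hasDerivAt_polylogArc_re 2 hy0 hy1)).sub
      ((hasDerivAt_polylogOneSubArc_re 2 hy0 hy1).const_mul 2)).congr_deriv ?_
    rw [polylogOneSubArc_two_re hy0 hy1]
    have h := polylogArc_two_im_add hy0 hy1
    simp only [Pi.mul_apply]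
    linear_combination (-2) * h
  · have h := ((((tendsto_id_nhdsGT_zero.mul tendsto_mul_log_two_sin).const_mul 2).add_const
      (riemannZeta 3).re).sub (tendsto_re_nhds (tendsto_polylogArc 1))).sub
      ((tendsto_re_nhds (tendsto_polylogOneSubArc 3)).const_mul 2)
    simpa using h

/-! ### Closed forms of the integrals -/

lemma logSinRatioIntegral_one_eq {z : ℝ} (h0 : 0 < z) (h1 : z < Real.pi / 2) :
    logSinRatioIntegral 1 z =
      -(z / 2 * (polylogOneSubArc 2 z).im - 1 / 2 * (polylogOneSubArc 3 z).re) := by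
  refine eq_of_hasDerivAt_eq (fun y hy0 hy1 => hasDerivAt_logSinRatioIntegral 0 hy0 hy1)
    (fun y hy0 hy1 => ((((hasDerivAt_id' y).div_const 2).fun_mul
      (hasDerivAt_polylogOneSubArc_im 1 hy0 hy1)).fun_sub
      ((hasDerivAt_polylogOneSubArc_re 2 hy0 hy1).const_mul (1 / 2))).fun_neg)
    (fun y hy0 hy1 => ?_) (tendsto_logSinRatioIntegral 1) ?_ h0 h1
  · rw [logSinRatioIntegral_zero, polylogOneSubArc_two_re hy0 hy1]
    simp [polylogOneSubArc_one hy0 hy1]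
    ring
  · have h := (((tendsto_id_nhdsGT_zero.div_const 2).mul
      (tendsto_im_nhds (tendsto_polylogOneSubArc 2))).sub
      ((tendsto_re_nhds (tendsto_polylogOneSubArc 3)).const_mul (1 / 2))).neg
    simpa using h

lemma logSinRatioIntegral_two_eq {z : ℝ} (h0 : 0 < z) (h1 : z < Real.pi / 2) :
    logSinRatioIntegral 2 z =
      -(-(z ^ 4 / 4) + (polylogOneSubArc 4 z).re - z * (polylogOneSubArc 3 z).im) := by
  refine eq_of_hasDerivAt_eq (fun y hy0 hy1 => hasDerivAt_logSinRatioIntegral 1 hy0 hy1)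
    (fun y hy0 hy1 => (((((hasDerivAt_pow 4 y).div_const 4).fun_neg).fun_add
      (hasDerivAt_polylogOneSubArc_re 3 hy0 hy1)).fun_sub
      ((hasDerivAt_id' y).fun_mul (hasDerivAt_polylogOneSubArc_im 2 hy0 hy1))).fun_neg)
    (fun y hy0 hy1 => ?_) (tendsto_logSinRatioIntegral 2) ?_ h0 h1
  · rw [logSinRatioIntegral_one_eq hy0 hy1, polylogOneSubArc_two_re hy0 hy1]
    push_cast
    ring
  · have h := ((((tendsto_id_nhdsGT_zero.pow 4).div_const 4).neg.add
      (tendsto_re_nhds (tendsto_polylogOneSubArc 4))).sub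
      (tendsto_id_nhdsGT_zero.mul (tendsto_im_nhds (tendsto_polylogOneSubArc 3)))).neg
    simpa using h

lemma logSinRatioIntegral_three_eq {z : ℝ} (h0 : 0 < z) (h1 : z < Real.pi / 2) :
    logSinRatioIntegral 3 z =
      -(3 / 4 * (z ^ 4 * Real.log (2 * Real.sin z)) + 3 / 8 * (riemannZeta 5).re +
        3 / 4 * (riemannZeta 3).re * z ^ 2 +
        3 / 4 * (z * ((polylogArc 4 z).im + 4 * (polylogOneSubArc 4 z).im)) -
        3 / 8 * ((polylogArc 5 z).re + 8 * (polylogOneSubArc 5 z).re)) := by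
  refine eq_of_hasDerivAt_eq (fun y hy0 hy1 => hasDerivAt_logSinRatioIntegral 2 hy0 hy1)
    (fun y hy0 hy1 => (((((((hasDerivAt_pow 4 y).fun_mul
      (hasDerivAt_log_two_sin hy0 hy1)).const_mul (3 / 4)).add_const _).fun_add
      ((hasDerivAt_pow 2 y).const_mul _)).fun_add
      (((hasDerivAt_id' y).fun_mul ((hasDerivAt_polylogArc_im 3 hy0 hy1).fun_add
        ((hasDerivAt_polylogOneSubArc_im 3 hy0 hy1).const_mul 4))).const_mul (3 / 4))).fun_sub
      (((hasDerivAt_polylogArc_re 4 hy0 hy1).fun_add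
        ((hasDerivAt_polylogOneSubArc_re 4 hy0 hy1).const_mul 8)).const_mul (3 / 8))).fun_neg)
    (fun y hy0 hy1 => ?_) (tendsto_logSinRatioIntegral 3) ?_ h0 h1
  · rw [logSinRatioIntegral_two_eq hy0 hy1]
    have h := polylogArc_three_re hy0 hy1
    push_cast
    -- The terms free of cot z add up to -(3/2) y times the vanishing left side of `h`; those with
    -- cot z give -3 cot z · J_2.
    linear_combination (3 / 2 * y) * h
  -- At 0 the ζ(5) term cancels against the limit of Re Li_5(u), while Im Li_4(u) converges and is
  -- multiplied by z.
  · have h4 : Tendsto (fun z : ℝ => z ^ 4 * Real.log (2 * Real.sin z)) (𝓝[>] 0) (𝓝 0) := by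
      have := (tendsto_id_nhdsGT_zero.pow 3).mul tendsto_mul_log_two_sin
      simp only [← mul_assoc, ← pow_succ] at this
      simpa using this
    have h := (((((h4.const_mul (3 / 4)).add_const (3 / 8 * (riemannZeta 5).re)).add
      ((tendsto_id_nhdsGT_zero.pow 2).const_mul (3 / 4 * (riemannZeta 3).re))).add
      ((tendsto_id_nhdsGT_zero.mul ((tendsto_im_nhds (tendsto_polylogArc 2)).add
        ((tendsto_im_nhds (tendsto_polylogOneSubArc 4)).const_mul 4))).const_mul (3 / 4))).sub
      (((tendsto_re_nhds (tendsto_polylogArc 3)).add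
        ((tendsto_re_nhds (tendsto_polylogOneSubArc 5)).const_mul 8)).const_mul (3 / 8))).neg
    simpa using h

/-- Here `u = e^{-2iz}`. For `m = 3, 4, 5` the statement says that the integral defining
`ls_m^{(1)}(z)` and the central binomial series both converge, and evaluates them. -/
theorem mainTheorem6 (z : ℝ) (hz0 : 0 < z) (hz : z < Real.pi / 2) (u : ℂ)
    (hu : u = Complex.exp (-2 * Complex.I * (z : ℂ))) :
    (∀ m ∈ ({3, 4, 5} : Finset ℕ),
      IntervalIntegrable (fun t : ℝ => t ^ 1 * Real.log (Real.sin t / Real.sin z) ^ (m - 1 - 1))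
        MeasureTheory.volume 0 z ∧
      Summable (fun n : ℕ => (2 * Real.sin z) ^ (2 * (n + 1)) /
        (((n + 1 : ℕ) : ℝ) ^ m * ((2 * (n + 1)).choose (n + 1) : ℝ)))) ∧
    (normLogSine 3 1 z =
        1 / 8 * ∑' n : ℕ, (2 * Real.sin z) ^ (2 * (n + 1)) /
          (((n + 1 : ℕ) : ℝ) ^ 3 * ((2 * (n + 1)).choose (n + 1) : ℝ)) ∧
      normLogSine 3 1 z =
        z / 2 * (polylog 2 (1 - u)).im - 1 / 2 * (polylog 3 (1 - u)).re) ∧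
    (normLogSine 4 1 z =
        -(1 / 8) * ∑' n : ℕ, (2 * Real.sin z) ^ (2 * (n + 1)) /
          (((n + 1 : ℕ) : ℝ) ^ 4 * ((2 * (n + 1)).choose (n + 1) : ℝ)) ∧
      normLogSine 4 1 z =
        -(z ^ 4 / 4) + (polylog 4 (1 - u)).re - z * (polylog 3 (1 - u)).im) ∧
    (normLogSine 5 1 z =
        3 / 16 * ∑' n : ℕ, (2 * Real.sin z) ^ (2 * (n + 1)) /
          (((n + 1 : ℕ) : ℝ) ^ 5 * ((2 * (n + 1)).choose (n + 1) : ℝ)) ∧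
      normLogSine 5 1 z =
        3 * z ^ 4 / 4 * Real.log (2 * Real.sin z) + 3 / 8 * (riemannZeta 5).re
          + 3 * z ^ 2 / 4 * (riemannZeta 3).re
          + 3 * z / 4 * ((polylog 4 u).im + 4 * (polylog 4 (1 - u)).im)
          - 3 / 8 * ((polylog 5 u).re + 8 * (polylog 5 (1 - u)).re)) := by
  have hint : ∀ p : ℕ, IntervalIntegrable
      (fun t : ℝ => t ^ 1 * Real.log (Real.sin t / Real.sin z) ^ p) volume 0 z := fun p => by
    simpa using intervalIntegrable_mul_log_sin_div_pow p hz0.le le_rfl hz.le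
  have hser : ∀ p : ℕ, normLogSine (p + 2) 1 z =
      -((-1) ^ p * p.factorial / 2 ^ (p + 2) * centralBinomSum (p + 2) z) := fun p => by
    rw [normLogSine_one, logSinRatioIntegral_eq_centralBinomSum p hz0 hz]
  subst hu
  refine ⟨fun m hm => ⟨hint _, summable_centralBinomTerm m hz0 hz⟩, ⟨?_, ?_⟩, ⟨?_, ?_⟩, ?_, ?_⟩
  · refine (hser 1).trans ?_
    change _ = 1 / 8 * centralBinomSum 3 z
    norm_num
  · refine (normLogSine_one 1 z).trans ?_
    rw [logSinRatioIntegral_one_eq hz0 hz, neg_neg]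
    rfl
  · refine (hser 2).trans ?_
    change _ = -(1 / 8) * centralBinomSum 4 z
    norm_num [Nat.factorial]
  · refine (normLogSine_one 2 z).trans ?_
    rw [logSinRatioIntegral_two_eq hz0 hz, neg_neg]
    rfl
  · refine (hser 3).trans ?_
    change _ = 3 / 16 * centralBinomSum 5 z
    norm_num [Nat.factorial]
  · refine (normLogSine_one 3 z).trans ?_
    rw [logSinRatioIntegral_three_eq hz0 hz, neg_neg]
    simp only [polylogArc, polylogOneSubArc]
    ring
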